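/- Let $F$ be the field of meromorphic functions on $\mathbb{C}$ in the variable $x$, with the derivation $\partial = \frac{d}{dx}$ and the endomorphism $\tau : f(x) \mapsto f(x+1)$. Let $k = \{f \in F : f(x+1) = f(x)\}$ be the field of $1$-periodic meromorphic functions, and let $k(x) \subseteq F$ be the subfield generated by $k$ and $x$. An element $f \in F$ is called differentially algebraic over $k(x)$ if there is an integer $n \ge 0$ such that $f, \partial(f), \dots, \partial^n(f)$ are algebraically dependent over $k(x)$. Let $a \in \mathbb{C}(x)$ with $a \neq 0$, and let $z \in F$, $z \neq 0$, be a solution of $z(x+1) = a(x)\,z(x)$. Then $z$ is differentially algebraic over $k(x)$ if and only if there exist a nonzero $g \in \mathbb{C}(x)$ and $c \in \mathbb{C}$ such that $$a(x) = c\,\frac{g(x+1)}{g(x)}.$$ -/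

import Mathlib

noncomputable section

open Filter Topology

namespace MeroDiff

/-- The `ℂ`-algebra of functions `ℂ → ℂ` that are meromorphic at every point of `ℂ`. The values
at the (isolated) poles are irrelevant; they are forgotten in `MeroField`. -/
def meroFun : Subalgebra ℂ (ℂ → ℂ) where
  carrier := {f | Meromorphic f}
  mul_mem' hf hg := Meromorphic.mul hf hg
  add_mem' hf hg := Meromorphic.add hf hg
  algebraMap_mem' c := Meromorphic.const c

/-- The ideal of meromorphic functions that vanish outside a closed discrete set. -/
def negligible : Ideal meroFun where
  carrier := {f | (f : ℂ → ℂ) =ᶠ[codiscrete ℂ] 0}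
  add_mem' {f g} hf hg := by
    change ((f + g : meroFun) : ℂ → ℂ) =ᶠ[codiscrete ℂ] 0
    filter_upwards [hf, hg] with x h1 h2
    simp [h1, h2]
  zero_mem' := by
    change ((0 : meroFun) : ℂ → ℂ) =ᶠ[codiscrete ℂ] 0
    exact EventuallyEq.rfl
  smul_mem' c {f} hf := by
    change ((c * f : meroFun) : ℂ → ℂ) =ᶠ[codiscrete ℂ] 0
    filter_upwards [hf] with x h1
    simp [h1]

theorem mem_negligible {f : meroFun} :
    f ∈ negligible ↔ (f : ℂ → ℂ) =ᶠ[codiscrete ℂ] 0 := Iff.rfl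

theorem sub_mem_negligible {f g : meroFun} :
    f - g ∈ negligible ↔ (f : ℂ → ℂ) =ᶠ[codiscrete ℂ] g := by
  rw [mem_negligible]
  constructor
  · intro h
    filter_upwards [h] with x hx
    exact sub_eq_zero.1 hx
  · intro h
    filter_upwards [h] with x hx
    exact sub_eq_zero.2 hx

/-- By the identity theorem, a meromorphic function on `ℂ` that is not negligible has
no zeros outside a closed discrete set. -/
theorem eventually_ne_zero {f : meroFun} (hf : f ∉ negligible) :
    ∀ᶠ x in codiscrete ℂ, (f : ℂ → ℂ) x ≠ 0 := by
  have hm : Meromorphic (f : ℂ → ℂ) := f.2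
  have key : ∀ u, meromorphicOrderAt (f : ℂ → ℂ) u ≠ ⊤ := by
    rw [← hm.exists_meromorphicOrderAt_ne_top_iff_forall]
    by_contra! h
    apply hf
    rw [mem_negligible, EventuallyEq, eventually_iff, codiscrete,
      mem_codiscreteWithin_iff_forall_mem_nhdsNE]
    intro x _
    have := meromorphicOrderAt_eq_top_iff.1 (h x)
    simp only [Set.compl_univ, Set.union_empty]
    exact this
  rw [eventually_iff, codiscrete, mem_codiscreteWithin_iff_forall_mem_nhdsNE]
  intro x _
  have := (meromorphicOrderAt_ne_top_iff_eventually_ne_zero (hm x)).1 (key x)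
  simp only [Set.compl_univ, Set.union_empty]
  exact this

instance negligible_isMaximal : negligible.IsMaximal := by
  rw [Ideal.isMaximal_iff]
  constructor
  · intro h
    have h1 : ∀ᶠ x in codiscrete ℂ, (1 : ℂ) = 0 := h
    have h2 : ∀ᶠ x in 𝓝[≠] (0 : ℂ), (1 : ℂ) = 0 := by
      rw [eventually_iff, codiscrete, mem_codiscreteWithin_iff_forall_mem_nhdsNE] at h1
      simpa using h1 0 trivial
    obtain ⟨x, hx⟩ := h2.exists
    exact one_ne_zero hx
  · intro J f hJ hf hfJ
    let g : meroFun := ⟨(f : ℂ → ℂ)⁻¹, Meromorphic.inv f.2⟩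
    have h1 : f * g - 1 ∈ negligible := by
      rw [sub_mem_negligible]
      filter_upwards [eventually_ne_zero hf] with x hx
      exact mul_inv_cancel₀ hx
    have h2 : f * g ∈ J := J.mul_mem_right g hfJ
    have := J.sub_mem h2 (hJ h1)
    simpa using this

/-- The field of meromorphic functions over `ℂ`: two meromorphic functions are identified when
they agree outside a closed discrete set. -/
def MeroField : Type := meroFun ⧸ negligible

instance : Field MeroField := Ideal.Quotient.field negligible

instance : Algebra ℂ MeroField := inferInstanceAs (Algebra ℂ (meroFun ⧸ negligible))

/-- The class of a meromorphic function. -/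
def mk : meroFun →ₐ[ℂ] MeroField := Ideal.Quotient.mkₐ ℂ negligible

theorem mk_surjective : Function.Surjective mk := Ideal.Quotient.mk_surjective

theorem mk_eq_iff {f g : meroFun} : mk f = mk g ↔ (f : ℂ → ℂ) =ᶠ[codiscrete ℂ] g :=
  Ideal.Quotient.eq.trans sub_mem_negligible

/-- The element of the field given by a concrete meromorphic function. -/
def ofFun (f : ℂ → ℂ) (hf : Meromorphic f) : MeroField := mk ⟨f, hf⟩

theorem ofFun_eq_iff {f g : ℂ → ℂ} {hf : Meromorphic f} {hg : Meromorphic g} :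
    ofFun f hf = ofFun g hg ↔ f =ᶠ[codiscrete ℂ] g :=
  mk_eq_iff

theorem exists_ofFun (z : MeroField) : ∃ f hf, z = ofFun f hf := by
  obtain ⟨⟨f, hf⟩, rfl⟩ := mk_surjective z
  exact ⟨f, hf, rfl⟩

/-- The coordinate function `x`. -/
def X : MeroField := ofFun id (fun x => MeromorphicAt.id x)

/-- `f(x) ↦ f(x + 1)` on meromorphic functions. -/
def shiftFun : meroFun →ₐ[ℂ] meroFun where
  toFun f := ⟨fun x => (f : ℂ → ℂ) (x + 1), by
    exact Meromorphic.meromorphic_fun_comp_add_const_iff_meromorphic.2 f.2⟩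
  map_one' := rfl
  map_mul' _ _ := rfl
  map_zero' := rfl
  map_add' _ _ := rfl
  commutes' _ := rfl

theorem codiscrete_shift {f g : ℂ → ℂ} (h : f =ᶠ[codiscrete ℂ] g) :
    (fun x => f (x + 1)) =ᶠ[codiscrete ℂ] fun x => g (x + 1) := by
  rw [EventuallyEq, eventually_iff, codiscrete,
    mem_codiscreteWithin_iff_forall_mem_nhdsNE] at h ⊢
  intro x _
  have h1 := h (x + 1) trivial
  have ht : Tendsto (fun y : ℂ => y + 1) (𝓝[≠] x) (𝓝[≠] (x + 1)) := by
    apply tendsto_nhdsWithin_of_tendsto_nhds_of_eventually_within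
    · exact ((continuous_id.add continuous_const).tendsto x).mono_left nhdsWithin_le_nhds
    · filter_upwards [self_mem_nhdsWithin] with y hy
      simpa using hy
  simp only [Set.compl_univ, Set.union_empty] at h1 ⊢
  exact ht h1

/-- The endomorphism `τ : f(x) ↦ f(x + 1)` of the field of meromorphic functions. -/
def τ : MeroField →ₐ[ℂ] MeroField :=
  Ideal.quotientMapₐ negligible shiftFun (fun _ hf => codiscrete_shift hf)

theorem eventually_eventually_codiscrete {p : ℂ → Prop} (h : ∀ᶠ x in codiscrete ℂ, p x) :
    ∀ᶠ x in codiscrete ℂ, ∀ᶠ y in 𝓝 x, p y := by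
  have ho : IsOpen {x | p x} := (mem_codiscrete'.1 h).1
  filter_upwards [h] with x hx
  exact ho.mem_nhds hx

theorem eventually_analyticAt (f : meroFun) :
    ∀ᶠ x in codiscrete ℂ, AnalyticAt ℂ (f : ℂ → ℂ) x :=
  MeromorphicOn.eventually_codiscreteWithin_analyticAt _ (meromorphicOn_univ.2 f.2)

/-- The derivative of a meromorphic function (with junk values at the poles). -/
def derivFun (f : meroFun) : meroFun := ⟨deriv (f : ℂ → ℂ), Meromorphic.deriv f.2⟩

/-- The map `d/dx` on the field of meromorphic functions. -/
def derivMap : MeroField → MeroField :=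
  Quotient.lift (fun f => mk (derivFun f)) (by
    intro f g h
    have h' : f - g ∈ negligible := (Submodule.quotientRel_def negligible).1 h
    rw [sub_mem_negligible] at h'
    refine mk_eq_iff.2 ?_
    filter_upwards [eventually_eventually_codiscrete h'] with x hx
    exact EventuallyEq.deriv_eq hx)

theorem derivMap_ofFun (f : ℂ → ℂ) (hf : Meromorphic f) :
    derivMap (ofFun f hf) = ofFun (deriv f) hf.deriv := rfl

/-- The derivation `∂ = d/dx` of the field of meromorphic functions. -/
def D : Derivation ℂ MeroField MeroField where
  toFun := derivMap
  map_add' := by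
    intro a b
    obtain ⟨f, rfl⟩ := mk_surjective a
    obtain ⟨g, rfl⟩ := mk_surjective b
    refine mk_eq_iff.2 ?_
    filter_upwards [eventually_analyticAt f, eventually_analyticAt g] with x hf hg
    exact deriv_add hf.differentiableAt hg.differentiableAt
  map_smul' := by
    intro c a
    obtain ⟨f, rfl⟩ := mk_surjective a
    refine mk_eq_iff.2 ?_
    filter_upwards [eventually_analyticAt f] with x hf
    exact deriv_const_smul c hf.differentiableAt
  map_one_eq_zero' := by
    refine mk_eq_iff.2 ?_
    exact Eventually.of_forall fun x => deriv_const x (1 : ℂ)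
  leibniz' := by
    intro a b
    obtain ⟨f, rfl⟩ := mk_surjective a
    obtain ⟨g, rfl⟩ := mk_surjective b
    refine mk_eq_iff.2 ?_
    filter_upwards [eventually_analyticAt f, eventually_analyticAt g] with x hf hg
    refine (deriv_mul hf.differentiableAt hg.differentiableAt).trans ?_
    change _ = (f : ℂ → ℂ) x * deriv (g : ℂ → ℂ) x + (g : ℂ → ℂ) x * deriv (f : ℂ → ℂ) x
    ring

/-- The field `k` of `1`-periodic meromorphic functions over `ℂ`. -/
def periodicField : IntermediateField ℂ MeroField where
  carrier := {f | τ f = f}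
  mul_mem' {f g} hf hg := by
    change τ (f * g) = f * g
    rw [map_mul, show τ f = f from hf, show τ g = g from hg]
  add_mem' {f g} hf hg := by
    change τ (f + g) = f + g
    rw [map_add, show τ f = f from hf, show τ g = g from hg]
  algebraMap_mem' c := τ.commutes c
  inv_mem' f hf := by
    change τ f⁻¹ = f⁻¹
    rw [map_inv₀, show τ f = f from hf]

/-- The field `ℂ(x)` of rational functions, inside the field of meromorphic functions. -/
def ratField : IntermediateField ℂ MeroField := IntermediateField.adjoin ℂ {X}

/-- The field `K = k(x)`, inside the field of meromorphic functions. -/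
def baseField : IntermediateField periodicField MeroField :=
  IntermediateField.adjoin periodicField {X}

/-- `f` is differentially algebraic over the subfield `K` of `F`, with respect to the
derivation `δ` of `F`: for some `n ≥ 0` the elements `f, δ f, …, δⁿ f` are algebraically
dependent over `K`. -/
def DifferentiallyAlgebraic (K : Type*) {F : Type*} [Field K] [Field F] [Algebra K F]
    (δ : F → F) (f : F) : Prop :=
  ∃ n : ℕ, ¬ AlgebraicIndependent K (fun i : Fin (n + 1) => δ^[i] f)

end MeroDiff

end

/-! Put `y = ∂z/z` and `b = ∂a/a`. The equation `τ z = a z` becomes additive: `τ y = y + b`, hence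
`τ (∂ⁱ y) = ∂ⁱ y + ∂ⁱ b` for all `i`. If `z` is differentially algebraic, so is `y`
(`MeroDiff.DifferentiallyAlgebraic.logDeriv`), and `exists_coboundary_of_not_algebraicIndependent`
turns a dependence among the `∂ⁱ y` into `∑ cᵢ ∂ⁱ b = τ e - e` with `e`, `cᵢ` in `k(x)`, the `cᵢ`
periodic and not all zero.

Now write `a = c ∏ (x - r)^(n r) · τ h / h` with every `r` in the strip `0 ≤ re r < 1`, so that
distinct `r` lie in distinct `ℤ`-orbits. Modulo coboundaries `b` is `∑ n r / (x - r)`. If some `n r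
≠ 0`, the combination has a pole at `r` and nowhere else on `r + ℤ`, which
`coboundary_mem_regularAt` forbids. Hence `n = 0` and `a = c · τ h / h`.

Conversely, if `a = c · τ g / g`, then `τ` multiplies `z / g` by a constant, so the logarithmic
derivative of `z / g` is periodic and `∂z/z` lies in `k(x)`. -/

/-! ### Differential algebraicity of the logarithmic derivative -/

/-- The elements algebraic over a subalgebra that a derivation sends into algebraic elements
are stable under the derivation. -/
theorem Derivation.mem_algebraicClosure_of_mem {R K F : Type*} [CommSemiring R] [Field K] [Field F]
    [CharZero F] [Algebra R F] [Algebra K F] (d : Derivation R F F) (B : Subalgebra K F)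
    (hB : ∀ b ∈ B, d b ∈ Subalgebra.algebraicClosure B F) {a : F}
    (ha : a ∈ Subalgebra.algebraicClosure B F) :
    d a ∈ Subalgebra.algebraicClosure B F := by
  classical
  set A := Subalgebra.algebraicClosure B F
  -- The difference is `P` with differentiated coefficients, evaluated at `a`.
  have key : ∀ P : Polynomial B,
      d (Polynomial.aeval a P) - Polynomial.aeval a (Polynomial.derivative P) * d a ∈ A := by
    intro P
    induction P using Polynomial.induction_on' with
    | add p q hp hq =>
      have := A.add_mem hp hq
      convert this using 1
      simp only [map_add]
      ring
    | monomial n c =>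
      have h1 : d (Polynomial.aeval a (Polynomial.monomial n c)) -
          Polynomial.aeval a (Polynomial.derivative (Polynomial.monomial n c)) * d a
          = a ^ n * d (c : F) := by
        simp only [Polynomial.aeval_monomial, Polynomial.derivative_monomial, Derivation.leibniz,
          Derivation.leibniz_pow, smul_eq_mul, nsmul_eq_mul, map_mul]
        change (c : F) * _ + a ^ n * d (c : F) - _ = _
        change (c : F) * _ + a ^ n * d (c : F) - (c : F) * _ * _ * _ = _
        rw [show algebraMap B F (n : B) = (n : F) from rfl]
        ring
      rw [h1]
      exact A.mul_mem (A.pow_mem ha n) (hB c c.2)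
  -- For a relation `P` of least degree `P'(a) ≠ 0` in characteristic zero, so `key` can be solved
  -- for `d a`.
  have hex : ∃ n, ∃ P : Polynomial B, P ≠ 0 ∧ Polynomial.aeval a P = 0 ∧ P.natDegree = n := by
    obtain ⟨P, h1, h2⟩ := (show IsAlgebraic B a from ha)
    exact ⟨_, P, h1, h2, rfl⟩
  obtain ⟨P, hP0, hPa, hPn⟩ := Nat.find_spec hex
  have hdeg : P.natDegree ≠ 0 := by
    intro h
    rw [Polynomial.eq_C_of_natDegree_eq_zero h] at hPa hP0
    rw [Polynomial.aeval_C] at hPa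
    apply hP0
    rw [(FaithfulSMul.algebraMap_eq_zero_iff B F).1 hPa, Polynomial.C_0]
  have hP' : Polynomial.aeval a (Polynomial.derivative P) ≠ 0 := by
    intro h
    have hlt := Polynomial.natDegree_derivative_lt hdeg
    rw [hPn] at hlt
    refine Nat.find_min hex hlt ⟨_, ?_, h, rfl⟩
    intro h0
    have : CharZero B := ⟨fun m n h => by simpa using congrArg Subtype.val h⟩
    exact hdeg (Polynomial.derivative_eq_zero.1 h0)
  have h1 := key P
  rw [hPa, map_zero, zero_sub] at h1
  have h2 : Polynomial.aeval a (Polynomial.derivative P) ∈ A := by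
    rw [Polynomial.aeval_eq_sum_range]
    refine A.sum_mem fun i _ => ?_
    exact A.smul_mem (A.pow_mem ha i) _
  have h3 : (Polynomial.aeval a (Polynomial.derivative P))⁻¹ ∈ A := IsAlgebraic.inv h2
  have := A.mul_mem (A.neg_mem h1) h3
  convert this using 1
  field_simp

/-- A finite family of elements algebraic over the algebra generated by a smaller set is
algebraically dependent. -/
theorem not_algebraicIndependent_of_card_lt {K F ι : Type*} [Field K] [Field F] [Algebra K F]
    [Fintype ι] (S : Finset F) (g : ι → F)
    (hg : ∀ i, g i ∈ Subalgebra.algebraicClosure (Algebra.adjoin K (S : Set F)) F)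
    (h : S.card < Fintype.card ι) : ¬ AlgebraicIndependent K g := by
  intro hind
  have h1 : (AlgebraicIndependent.matroid K F).Indep (Set.range g) := by
    rw [AlgebraicIndependent.matroid_indep_iff]
    exact hind.coe_range
  have h2 : Set.range g ⊆ (AlgebraicIndependent.matroid K F).closure (S : Set F) := by
    rw [AlgebraicIndependent.matroid_closure_eq]
    rintro _ ⟨i, rfl⟩
    exact hg i
  have h3 := h1.encard_le_eRk_of_subset h2
  rw [Matroid.eRk_closure_eq] at h3
  have h4 := h3.trans (Matroid.eRk_le_encard _ _)
  rw [← Set.image_univ, hind.injective.encard_image, Set.encard_univ, Set.encard_coe_eq_coe_finsetCard, ENat.card_eq_coe_fintype_card]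
    at h4
  exact absurd (by exact_mod_cast h4) (not_le.2 h)

open MeroDiff in
/-- If `f` is differentially algebraic, so is its logarithmic derivative. -/
theorem MeroDiff.DifferentiallyAlgebraic.logDeriv {R K F : Type*} [CommSemiring R] [Field K] [Field F]
    [CharZero F] [Algebra R F] [Algebra K F] (d : Derivation R F F)
    (hK : ∀ c : K, ∃ c' : K, d (algebraMap K F c) = algebraMap K F c') {f : F}
    (hf : DifferentiallyAlgebraic K d f) : DifferentiallyAlgebraic K d (d f / f) := by
  classical
  -- With `n` least, `dⁿ f` is algebraic over the first `n` iterates. Their algebraic closure `A` is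
  -- therefore a differential field containing every iterate of `d f / f`, and `n + 1` of these
  -- cannot be independent.
  let n := Nat.find hf
  have hn : ¬ AlgebraicIndependent K (fun i : Fin (n + 1) => d^[i] f) := Nat.find_spec hf
  have hlow : AlgebraicIndependent K (fun i : Fin n => d^[i] f) := by
    rcases hm : n with _ | m
    · exact algebraicIndependent_empty_type_iff.2 (algebraMap K F).injective
    · exact not_not.1 (Nat.find_min hf (by omega : m < Nat.find hf))
  let S : Finset F := (Finset.range n).image fun i => d^[i] f
  have hS : (S : Set F) = Set.range fun i : Fin n => d^[i] f := by
    ext x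
    simp only [S, Finset.coe_image, Finset.coe_range, Set.mem_image, Set.mem_Iio, Set.mem_range]
    exact ⟨fun ⟨i, hi, h⟩ => ⟨⟨i, hi⟩, h⟩, fun ⟨i, h⟩ => ⟨i, i.2, h⟩⟩
  have hScard : S.card ≤ n := Finset.card_image_le.trans (by simp)
  set B := Algebra.adjoin K (S : Set F) with hBdef
  set A := Subalgebra.algebraicClosure B F
  have hBA : ∀ b ∈ B, b ∈ A := fun b hb => isAlgebraic_algebraMap (⟨b, hb⟩ : B)
  have htop : d^[n] f ∈ A := by
    by_contra h
    have h' : Transcendental B (d^[n] f) := h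
    rw [hBdef, hS] at h'
    have := (hlow.option_iff_transcendental (d^[n] f)).2 h'
    apply hn
    have h2 := this.comp (fun i : Fin (n + 1) => if h : (i : ℕ) < n then some (⟨i, h⟩ : Fin n)
      else none) (by
        intro i j hij
        ext
        by_cases hi : (i : ℕ) < n <;> by_cases hj : (j : ℕ) < n <;> simp [hi, hj] at hij <;> omega)
    convert h2 using 1
    ext i
    by_cases hi : (i : ℕ) < n
    · simp [hi]
    · have : (i : ℕ) = n := by omega
      simp [this]
  have hder : ∀ b ∈ B, d b ∈ A := by
    intro b hb
    induction hb using Algebra.adjoin_induction with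
    | mem x hx =>
      rw [hS] at hx
      obtain ⟨i, rfl⟩ := hx
      change d (d^[i] f) ∈ A
      rw [← Function.iterate_succ_apply' d]
      rcases Nat.lt_or_ge (i + 1) n with h | h
      · apply hBA
        apply Algebra.subset_adjoin
        rw [hS]
        exact ⟨⟨i + 1, h⟩, rfl⟩
      · have : (i : ℕ).succ = n := by omega
        rwa [this]
    | algebraMap r =>
      obtain ⟨c', hc⟩ := hK r
      rw [hc]
      exact hBA _ (B.algebraMap_mem c')
    | add x y _ _ hx hy => rw [map_add]; exact A.add_mem hx hy
    | mul x y hx' hy' hx hy =>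
      rw [Derivation.leibniz]
      exact A.add_mem (A.mul_mem (hBA _ hx') hy) (A.mul_mem (hBA _ hy') hx)
  have hstab : ∀ a ∈ A, d a ∈ A := fun a ha => d.mem_algebraicClosure_of_mem B hder ha
  have hfA : f ∈ A := by
    rcases Nat.eq_zero_or_pos n with h | h
    · rw [h] at htop
      exact htop
    · apply hBA
      apply Algebra.subset_adjoin
      rw [hS]
      exact ⟨⟨0, h⟩, rfl⟩
  have hgA : d f / f ∈ A := by
    rw [div_eq_mul_inv]
    exact A.mul_mem (hstab f hfA) (IsAlgebraic.inv hfA)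
  refine ⟨n, not_algebraicIndependent_of_card_lt S _ ?_ (by simpa using Nat.lt_succ_of_le hScard)⟩
  intro i
  generalize (i : ℕ) = j
  induction j with
  | zero => exact hgA
  | succ j ih =>
    rw [Function.iterate_succ_apply']
    exact hstab _ ih

/-! ### Logarithmic derivatives and iterated derivatives -/

namespace Derivation

variable {R F : Type*} [CommSemiring R] [Field F] [Algebra R F] (d : Derivation R F F)

theorem map_inv (a : F) : d a⁻¹ = -a⁻¹ ^ 2 * d a := by
  rcases eq_or_ne a 0 with rfl | ha
  · simp
  · have h : d (a * a⁻¹) = 0 := by rw [mul_inv_cancel₀ ha, d.map_one_eq_zero]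
    rw [leibniz, smul_eq_mul, smul_eq_mul] at h
    field_simp
    field_simp at h
    linear_combination h

theorem logDeriv_mul {a b : F} (ha : a ≠ 0) (hb : b ≠ 0) :
    d (a * b) / (a * b) = d a / a + d b / b := by
  rw [leibniz, smul_eq_mul, smul_eq_mul]
  field_simp
  ring

theorem logDeriv_inv (a : F) : d a⁻¹ / a⁻¹ = -(d a / a) := by
  rcases eq_or_ne a 0 with rfl | ha
  · simp
  · rw [map_inv]
    field_simp

theorem logDeriv_div {a b : F} (ha : a ≠ 0) (hb : b ≠ 0) :
    d (a / b) / (a / b) = d a / a - d b / b := by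
  rw [div_eq_mul_inv a b, logDeriv_mul d ha (inv_ne_zero hb), logDeriv_inv, sub_eq_add_neg]

theorem logDeriv_pow {a : F} (ha : a ≠ 0) (n : ℕ) : d (a ^ n) / a ^ n = n * (d a / a) := by
  induction n with
  | zero => simp
  | succ n ih =>
    rw [pow_succ, logDeriv_mul d (pow_ne_zero n ha) ha, ih]
    push_cast
    ring

theorem logDeriv_zpow {a : F} (ha : a ≠ 0) (n : ℤ) : d (a ^ n) / a ^ n = n * (d a / a) := by
  obtain ⟨n, rfl | rfl⟩ := n.eq_nat_or_neg
  · rw [zpow_natCast, logDeriv_pow d ha, Int.cast_natCast]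
  · rw [zpow_neg, logDeriv_inv, zpow_natCast, logDeriv_pow d ha, Int.cast_neg, Int.cast_natCast,
      neg_mul]

theorem logDeriv_prod {ι : Type*} (s : Finset ι) (f : ι → F) (hf : ∀ i ∈ s, f i ≠ 0) :
    d (∏ i ∈ s, f i) / ∏ i ∈ s, f i = ∑ i ∈ s, d (f i) / f i := by
  classical
  induction s using Finset.induction_on with
  | empty => simp
  | insert i s hi ih =>
    rw [Finset.prod_insert hi, Finset.sum_insert hi,
      logDeriv_mul d (hf i (Finset.mem_insert_self i s))
        (Finset.prod_ne_zero_iff.2 fun j hj => hf j (Finset.mem_insert_of_mem hj)),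
      ih fun j hj => hf j (Finset.mem_insert_of_mem hj)]

theorem iterate_inv {t : F} (ht : d t = 1) (i : ℕ) :
    d^[i] t⁻¹ = ((-1) ^ i * i.factorial : ℤ) * t⁻¹ ^ (i + 1) := by
  induction i with
  | zero => simp
  | succ i ih =>
    have hc : ∀ m : ℤ, d (m : F) = 0 := fun m => by
      rw [← zsmul_one, map_zsmul, d.map_one_eq_zero, smul_zero]
    rw [Function.iterate_succ_apply', ih, leibniz, hc, leibniz_pow, map_inv, ht]
    simp only [smul_eq_mul, nsmul_eq_mul, Nat.factorial_succ, Nat.add_sub_cancel]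
    push_cast
    ring

theorem iterate_add (i : ℕ) (a b : F) : d^[i] (a + b) = d^[i] a + d^[i] b :=
  iterate_map_add d i a b

theorem iterate_sum_intCast_mul {ι : Type*} (s : Finset ι) (k : ι → ℤ) (f : ι → F) (i : ℕ) :
    d^[i] (∑ j ∈ s, k j * f j) = ∑ j ∈ s, k j * d^[i] (f j) := by
  induction i with
  | zero => rfl
  | succ i ih =>
    rw [Function.iterate_succ_apply', ih, map_sum]
    refine Finset.sum_congr rfl fun j _ => ?_
    rw [← zsmul_eq_mul, map_zsmul, zsmul_eq_mul, Function.iterate_succ_apply']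

end Derivation

/-! ### Semilinear translations and the additive Kolchin-Ostrowski theorem -/

namespace MvPolynomial

variable {ι K : Type*} [Field K]

/-- The semilinear substitution `X i ↦ X i + b i`, acting on the coefficients by `σ`. -/
noncomputable def translate (σ : K →+* K) (b : ι → K) : MvPolynomial ι K →+* MvPolynomial ι K :=
  eval₂Hom (C.comp σ) fun i => X i + C (b i)

@[simp]
theorem translate_C (σ : K →+* K) (b : ι → K) (c : K) : translate σ b (C c) = C (σ c) := by
  simp [translate]

@[simp]
theorem translate_X (σ : K →+* K) (b : ι → K) (i : ι) : translate σ b (X i) = X i + C (b i) := by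
  simp [translate]

/-- The shifts `b i` are constants, so the chain rule adds no factor. Partial derivatives of an
invariant polynomial are thus invariant. -/
theorem translate_pderiv (σ : K →+* K) (b : ι → K) (i : ι) (P : MvPolynomial ι K) :
    pderiv i (translate σ b P) = translate σ b (pderiv i P) := by
  classical
  induction P using MvPolynomial.induction_on with
  | C a => simp
  | add p q hp hq => simp [hp, hq]
  | mul_X p j hp =>
    simp only [map_mul, translate_X, Derivation.leibniz, smul_eq_mul, map_add, hp, pderiv_C,
      add_zero, pderiv_X]
    rcases eq_or_ne i j with rfl | h <;> simp [*]

/-- `translate` lifts `τ` through evaluation at `y`, so it sends relations among the `y i` to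
relations. -/
theorem aeval_translate {F : Type*} [Field F] [Algebra K F] (σ : K →+* K) (τ : F →+* F)
    (hτ : ∀ c, τ (algebraMap K F c) = algebraMap K F (σ c)) (b : ι → K) (y : ι → F)
    (hy : ∀ i, τ (y i) = y i + algebraMap K F (b i)) (P : MvPolynomial ι K) :
    aeval y (translate σ b P) = τ (aeval y P) := by
  induction P using MvPolynomial.induction_on with
  | C a => simp [hτ]
  | add p q hp hq => simp [hp, hq]
  | mul_X p j hp => simp [hp, hy]

theorem translate_monomial (σ : K →+* K) (b : ι → K) (m : ι →₀ ℕ) (c : K) :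
    translate σ b (monomial m c) = C (σ c) * m.prod fun i e => (X i + C (b i)) ^ e := by
  simp [translate, eval₂_monomial]

section MonomialOrder

variable (m : MonomialOrder ι)

theorem degree_X_add_C (i : ι) (c : K) :
    m.degree (X i + C c : MvPolynomial ι K) = Finsupp.single i 1 := by
  rw [m.degree_add_of_lt, m.degree_X]
  rw [m.degree_X, m.degree_C, map_zero]
  rw [MonomialOrder.toSyn_lt_iff_ne_zero]
  simp

theorem monic_X_add_C (i : ι) (c : K) : m.Monic (X i + C c : MvPolynomial ι K) := by
  refine MonomialOrder.Monic.add_of_lt m.monic_X ?_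
  rw [m.degree_X, m.degree_C, map_zero]
  rw [MonomialOrder.toSyn_lt_iff_ne_zero]
  simp

theorem monic_prod_X_add_C (b : ι → K) (e : ι →₀ ℕ) :
    m.Monic (e.prod fun i k => (X i + C (b i) : MvPolynomial ι K) ^ k) :=
  MonomialOrder.Monic.prod fun i _ => (monic_X_add_C m i (b i)).pow

theorem degree_prod_X_add_C (b : ι → K) (e : ι →₀ ℕ) :
    m.degree (e.prod fun i k => (X i + C (b i) : MvPolynomial ι K) ^ k) = e := by
  rw [Finsupp.prod, m.degree_prod]
  · simp_rw [m.degree_pow, degree_X_add_C]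
    conv_rhs => rw [← Finsupp.sum_single e]
    simp [Finsupp.sum]
  · intro i _
    exact pow_ne_zero _ (monic_X_add_C m i (b i)).ne_zero

/-- Each monomial becomes a monic polynomial with the same leading exponent, so no smaller monomial
of `P` contributes at `d`. -/
theorem coeff_translate (σ : K →+* K) (b : ι → K) (P : MvPolynomial ι K) {d : ι →₀ ℕ}
    (hd : m.toSyn (m.degree P) ≤ m.toSyn d) :
    coeff d (translate σ b P) = σ (coeff d P) := by
  classical
  conv_lhs => rw [P.as_sum]
  rw [map_sum, coeff_sum]
  have h : ∀ e ∈ P.support, coeff d (translate σ b (monomial e (coeff e P))) =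
      if e = d then σ (coeff d P) else 0 := by
    intro e he
    rw [translate_monomial, coeff_C_mul]
    have h1 := degree_prod_X_add_C m b e
    split_ifs with hed
    · subst hed
      have h2 := (monic_prod_X_add_C m b e).coeff_degree
      rw [h1] at h2
      rw [h2, mul_one]
    · refine mul_eq_zero_of_right _ (m.coeff_eq_zero_of_lt ?_)
      rw [h1]
      refine lt_of_le_of_ne ((m.le_degree he).trans hd) ?_
      exact fun h => hed (m.toSyn.injective h)
  rw [Finset.sum_congr rfl h, Finset.sum_ite_eq']
  split_ifs with hs
  · rfl
  · rw [notMem_support_iff.1 hs, map_zero]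

end MonomialOrder

theorem totalDegree_pderiv_lt (i : ι) {Q : MvPolynomial ι K} (hQ : Q.totalDegree ≠ 0) :
    (pderiv i Q).totalDegree < Q.totalDegree := by
  rw [totalDegree, Finset.sup_lt_iff (Nat.pos_of_ne_zero hQ)]
  intro m hm
  rw [mem_support_iff, coeff_pderiv] at hm
  have h := le_totalDegree (mem_support_iff.2 (left_ne_zero_of_mul hm))
  rw [Finsupp.sum_add_index' (fun _ => rfl) (fun _ _ _ => rfl), Finsupp.sum_single_index rfl] at h
  exact h

theorem eq_C_of_pderiv_eq_zero [CharZero K] {Q : MvPolynomial ι K}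
    (h : ∀ i, pderiv i Q = 0) : Q = C (coeff 0 Q) := by
  classical
  ext m
  rw [coeff_C]
  split_ifs with hm
  · rw [hm]
  · obtain ⟨i, hi⟩ : ∃ i, m i ≠ 0 := by
      by_contra! hc
      exact hm (Finsupp.ext fun i => (hc i)).symm
    have h1 := congrArg (coeff (m - Finsupp.single i 1)) (h i)
    have h2 : m - Finsupp.single i 1 + Finsupp.single i 1 = m :=
      tsub_add_cancel_of_le (Finsupp.single_le_iff.2 (Nat.one_le_iff_ne_zero.2 hi))
    rw [coeff_pderiv, h2, coeff_zero] at h1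
    refine (mul_eq_zero.1 h1).resolve_right ?_
    exact Nat.cast_add_one_ne_zero _

end MvPolynomial

open MvPolynomial in
/-- The additive Kolchin-Ostrowski theorem for difference fields: solutions of
`τ y = y + b` over `K`, whose constants all lie in `K`, are algebraically dependent only if some
constant combination of the right-hand sides is a coboundary. -/
theorem exists_coboundary_of_not_algebraicIndependent {ι K F : Type*} [Finite ι] [Field K]
    [CharZero K] [Field F] [Algebra K F] (σ : K →+* K) (τ : F →+* F)
    (hτ : ∀ c, τ (algebraMap K F c) = algebraMap K F (σ c)) (b : ι → K) (y : ι → F)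
    (hy : ∀ i, τ (y i) = y i + algebraMap K F (b i)) (hdep : ¬ AlgebraicIndependent K y) :
    ∃ (c : ι → K) (e : K), c ≠ 0 ∧ (∀ i, σ (c i) = c i) ∧
      ∑ᶠ i, c i * b i = σ e - e := by
  classical
  cases nonempty_fintype ι
  let _ : LinearOrder ι := LinearOrder.lift' (Fintype.equivFin ι) (Fintype.equivFin ι).injective
  let m : MonomialOrder ι := MonomialOrder.lex
  -- a relation that is minimal for the monomial order can be scaled to be invariant
  have hinv : ∃ P : MvPolynomial ι K, P ≠ 0 ∧ aeval y P = 0 ∧ translate σ b P = P := by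
    rw [algebraicIndependent_iff] at hdep
    push Not at hdep
    let T : Set m.syn :=
      {s | ∃ P : MvPolynomial ι K, P ≠ 0 ∧ aeval y P = 0 ∧ m.toSyn (m.degree P) = s}
    have hT : T.Nonempty := by
      obtain ⟨P, h1, h2⟩ := hdep
      exact ⟨_, P, h2, h1, rfl⟩
    obtain ⟨s, ⟨P, hP0, hPy, rfl⟩, hmin⟩ := WellFounded.has_min (wellFounded_lt (α := m.syn)) T hT
    let u := m.leadingCoeff P
    have hu : u ≠ 0 := m.leadingCoeff_ne_zero_iff.2 hP0
    let Q := C u⁻¹ * P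
    have hcoeff : ∀ d, coeff d Q = u⁻¹ * coeff d P := fun d => coeff_C_mul _ _ _
    have hQ0 : Q ≠ 0 := mul_ne_zero (C_ne_zero.2 (inv_ne_zero hu)) hP0
    have hQdeg : m.degree Q = m.degree P := by
      rw [m.degree_mul (C_ne_zero.2 (inv_ne_zero hu)) hP0, m.degree_C, zero_add]
    have hQ1 : coeff (m.degree Q) Q = 1 := by
      rw [hcoeff, hQdeg]
      exact inv_mul_cancel₀ hu
    have hQy : aeval y Q = 0 := by simp [Q, hPy]
    refine ⟨Q, hQ0, hQy, ?_⟩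
    by_contra hne
    -- `N` is again a relation, and the leading terms cancel because `Q` is monic, which contradicts
    -- minimality.
    let N := translate σ b Q - Q
    have hN0 : N ≠ 0 := sub_ne_zero.2 hne
    have hNy : aeval y N = 0 := by
      rw [map_sub, aeval_translate σ τ hτ b y hy, hQy, map_zero, sub_zero]
    apply hmin _ ⟨N, hN0, hNy, rfl⟩
    rw [← hQdeg]
    by_contra hle
    rw [not_lt] at hle
    have h1 : coeff (m.degree N) N ≠ 0 := m.coeff_degree_ne_zero_iff.2 hN0
    apply h1
    rw [coeff_sub, coeff_translate m σ b Q hle]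
    rcases hle.eq_or_lt with h | h
    · rw [← m.toSyn.injective h, hQ1, map_one, sub_self]
    · rw [m.coeff_eq_zero_of_lt h, map_zero, sub_zero]
  -- an invariant of minimal positive total degree is linear
  have hex : ∃ n, ∃ Q : MvPolynomial ι K, Q.totalDegree ≠ 0 ∧ translate σ b Q = Q ∧
      Q.totalDegree = n := by
    obtain ⟨P, hP0, hPy, hP⟩ := hinv
    refine ⟨_, P, ?_, hP, rfl⟩
    intro h
    rw [totalDegree_eq_zero_iff_eq_C] at h
    rw [h, aeval_C, FaithfulSMul.algebraMap_eq_zero_iff] at hPy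
    rw [hPy, C_0] at h
    exact hP0 h
  obtain ⟨Q, hQ0, hQ, hQn⟩ := Nat.find_spec hex
  -- The partial derivatives are invariant of smaller total degree, so minimality makes them
  -- constant.
  have hconst : ∀ i, pderiv i Q = C (coeff 0 (pderiv i Q)) := by
    intro i
    rw [← totalDegree_eq_zero_iff_eq_C]
    by_contra h
    refine Nat.find_min hex (hQn ▸ totalDegree_pderiv_lt i hQ0) ⟨_, h, ?_, rfl⟩
    rw [← translate_pderiv, hQ]
  let c : ι → K := fun i => coeff 0 (pderiv i Q)
  have hlin : Q = ∑ i, C (c i) * X i + C (coeff 0 (Q - ∑ i, C (c i) * X i)) := by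
    rw [← eq_C_of_pderiv_eq_zero (Q := Q - ∑ i, C (c i) * X i)]
    · ring
    · intro i
      rw [map_sub, hconst i, map_sum, Finset.sum_eq_single i]
      · simp [c]
      · intro j _ hji
        simp [pderiv_X_of_ne hji]
      · simp
  set e := coeff 0 (Q - ∑ i, C (c i) * X i)
  have hc : ∀ i, σ (c i) = c i := by
    intro i
    have h := translate_pderiv σ b i Q
    rw [hQ, hconst i, translate_C] at h
    exact (C_injective _ _ h).symm
  -- Constant terms in `translate σ b Q = Q` give `∑ c i * b i + σ e = e`, whence the sign.
  refine ⟨c, -e, ?_, hc, ?_⟩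
  · intro h0
    apply hQ0
    rw [totalDegree_eq_zero_iff_eq_C, hlin]
    simp [h0]
  · rw [finsum_eq_sum_of_fintype]
    have h := hQ
    rw [hlin] at h
    simp only [map_add, map_sum, map_mul, translate_C, translate_X, hc, mul_add,
      Finset.sum_add_distrib] at h
    apply C_injective ι K
    simp only [map_sum, map_mul, map_sub, map_neg]
    linear_combination h

/-! ### Shift and derivation on meromorphic functions -/

namespace MeroDiff

open Polynomial

instance : CharZero MeroField :=
  charZero_of_injective_algebraMap (algebraMap ℂ MeroField).injective

/-- A complex number, viewed as a constant meromorphic function. -/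
noncomputable abbrev const (c : ℂ) : MeroField := algebraMap ℂ MeroField c

theorem τ_X : τ X = X + 1 := rfl

theorem const_mul (c d : ℂ) : const (c * d) = const c * const d :=
  map_mul (algebraMap ℂ MeroField) c d

theorem const_inv (c : ℂ) : const c⁻¹ = (const c)⁻¹ := map_inv₀ (algebraMap ℂ MeroField) c

theorem τ_const (c : ℂ) : τ (const c) = const c := τ.commutes c

theorem D_const (c : ℂ) : D (const c) = 0 := D.map_algebraMap c

theorem D_X : D X = 1 := by
  refine mk_eq_iff.2 (Filter.Eventually.of_forall fun x => ?_)
  exact deriv_id x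

theorem D_τ (f : MeroField) : D (τ f) = τ (D f) := by
  obtain ⟨f, rfl⟩ := mk_surjective f
  refine mk_eq_iff.2 (Filter.Eventually.of_forall fun x => ?_)
  exact deriv_comp_add_const (f : ℂ → ℂ) 1 x

theorem τ_injective : Function.Injective τ := τ.toRingHom.injective

theorem mem_periodicField {f : MeroField} : f ∈ periodicField ↔ τ f = f := Iff.rfl

theorem const_mem_periodicField (c : ℂ) : const c ∈ periodicField := τ_const c

theorem D_mem_periodicField {f : MeroField} (hf : f ∈ periodicField) : D f ∈ periodicField := by
  rw [mem_periodicField] at hf ⊢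
  rw [← D_τ, hf]

theorem τ_aeval (p : periodicField[X]) :
    τ (aeval X p) = aeval X (p.comp (Polynomial.X + 1)) := by
  induction p using Polynomial.induction_on' with
  | add p q hp hq => simp [hp, hq]
  | monomial n c =>
    have hc : τ (algebraMap periodicField MeroField c) = algebraMap periodicField MeroField c := c.2
    rw [aeval_monomial, map_mul, map_pow, hc, τ_X, aeval_comp, aeval_monomial]
    simp

/-- `τ` fixes the coefficients, so a polynomial vanishing at `x` vanishes at every `x + m` and has
infinitely many roots. -/
theorem transcendental_X : Transcendental periodicField X := by
  rintro ⟨p, hp0, hp⟩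
  have h : ∀ m : ℕ, aeval (X + (m : MeroField)) p = 0 := by
    intro m
    have hroot : τ^[m] (aeval X p) = aeval (X + (m : MeroField)) p := by
      induction m with
      | zero => simp
      | succ m ih =>
        rw [Function.iterate_succ_apply', ih]
        have h1 : aeval (X + (m : MeroField)) p =
            aeval X (p.comp (Polynomial.X + (m : periodicField[X]))) := by simp [aeval_comp]
        rw [h1, τ_aeval]
        simp only [aeval_comp, map_add, aeval_X, map_natCast, map_one]
        congr 1
        push_cast
        ring_nf
    rw [← hroot, hp]
    exact iterate_map_zero τ m
  have h2 : p.map (algebraMap periodicField MeroField) = 0 := by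
    refine Polynomial.eq_zero_of_infinite_isRoot _ ?_
    refine Set.Infinite.mono ?_ (Set.infinite_range_of_injective
      (f := fun m : ℕ => X + (m : MeroField)) fun m n hmn => by simpa using hmn)
    rintro _ ⟨m, rfl⟩
    have := h m
    rwa [aeval_def, ← eval_map] at this
  exact hp0 (Polynomial.map_injective _ (algebraMap periodicField MeroField).injective
    (by rw [h2, Polynomial.map_zero]))

theorem aeval_X_eq_zero_iff {p : periodicField[X]} : aeval X p = 0 ↔ p = 0 :=
  ⟨fun h => transcendental_iff.1 transcendental_X p h, fun h => by rw [h, map_zero]⟩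

theorem X_sub_const_ne_zero (r : ℂ) : X - const r ≠ 0 := by
  intro h
  have h1 := congrArg τ (sub_eq_zero.1 h)
  rw [τ_const, τ_X, sub_eq_zero.1 h] at h1
  exact one_ne_zero (add_eq_left.1 h1)

/-! ### Stability of `k(x)` under `τ` and `∂` -/

section Closure

theorem X_mem_baseField : X ∈ baseField :=
  IntermediateField.mem_adjoin_simple_self periodicField X

theorem periodic_mem_baseField {f : MeroField} (hf : f ∈ periodicField) : f ∈ baseField :=
  baseField.algebraMap_mem ⟨f, hf⟩

theorem ratField_subset_baseField {f : MeroField} (hf : f ∈ ratField) : f ∈ baseField := by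
  induction hf using IntermediateField.adjoin_induction with
  | mem x hx =>
    rw [Set.mem_singleton_iff.1 hx]
    exact X_mem_baseField
  | algebraMap c => exact periodic_mem_baseField (const_mem_periodicField c)
  | add _ _ _ _ h1 h2 => exact add_mem h1 h2
  | mul _ _ _ _ h1 h2 => exact mul_mem h1 h2
  | inv _ _ h => exact inv_mem h

theorem τ_mem_baseField {f : MeroField} (hf : f ∈ baseField) : τ f ∈ baseField := by
  induction hf using IntermediateField.adjoin_induction with
  | mem x hx =>
    rw [Set.mem_singleton_iff.1 hx, τ_X]
    exact add_mem X_mem_baseField (one_mem _)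
  | algebraMap c =>
    rw [show τ (algebraMap periodicField MeroField c) = _ from c.2]
    exact baseField.algebraMap_mem c
  | add _ _ _ _ h1 h2 => rw [map_add]; exact add_mem h1 h2
  | mul _ _ _ _ h1 h2 => rw [map_mul]; exact mul_mem h1 h2
  | inv _ _ h => rw [map_inv₀]; exact inv_mem h

theorem D_mem_baseField {f : MeroField} (hf : f ∈ baseField) : D f ∈ baseField := by
  induction hf using IntermediateField.adjoin_induction with
  | mem x hx =>
    rw [Set.mem_singleton_iff.1 hx, D_X]
    exact one_mem _
  | algebraMap c => exact periodic_mem_baseField (D_mem_periodicField c.2)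
  | add _ _ _ _ h1 h2 => rw [map_add]; exact add_mem h1 h2
  | mul _ _ h h' h1 h2 =>
    rw [Derivation.leibniz]
    exact add_mem (mul_mem h h2) (mul_mem h' h1)
  | inv _ h h1 =>
    rw [D.map_inv]
    exact mul_mem (neg_mem (pow_mem (inv_mem h) 2)) h1

theorem iterate_D_mem_baseField {f : MeroField} (hf : f ∈ baseField) (i : ℕ) :
    D^[i] f ∈ baseField := by
  induction i with
  | zero => exact hf
  | succ i ih => rw [Function.iterate_succ_apply']; exact D_mem_baseField ih

/-- The restriction of `τ` to `k(x)`. -/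
noncomputable def τBase : baseField →+* baseField :=
  ((τ : MeroField →+* MeroField).comp (algebraMap baseField MeroField)).codRestrict
    baseField fun x => τ_mem_baseField x.2

theorem algebraMap_τBase (c : baseField) :
    τ (algebraMap baseField MeroField c) = algebraMap baseField MeroField (τBase c) := rfl

theorem X_sub_const_mem_ratField (r : ℂ) : X - const r ∈ ratField :=
  sub_mem (IntermediateField.mem_adjoin_simple_self ℂ X) (ratField.algebraMap_mem r)

end Closure

/-! ### Poles of elements of `k(x)` and of coboundaries -/

section Regular

/-- The elements of `k(x)` without a pole at `x = β`. -/
noncomputable def regularAt (β : ℂ) : Subalgebra periodicField MeroField where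
  carrier := {g | ∃ p q : periodicField[X],
    q.eval (algebraMap ℂ periodicField β) ≠ 0 ∧ g * aeval X q = aeval X p}
  mul_mem' := by
    rintro f g ⟨p, q, hq, h⟩ ⟨p', q', hq', h'⟩
    refine ⟨p * p', q * q', by simpa using ⟨hq, hq'⟩, ?_⟩
    rw [map_mul, map_mul, ← h, ← h']
    ring
  add_mem' := by
    rintro f g ⟨p, q, hq, h⟩ ⟨p', q', hq', h'⟩
    refine ⟨p * q' + p' * q, q * q', by simpa using ⟨hq, hq'⟩, ?_⟩
    rw [map_add, map_mul, map_mul, map_mul, ← h, ← h']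
    ring
  algebraMap_mem' c := ⟨C c, 1, by simp, by simp⟩

theorem τ_mem_regularAt_iff {β : ℂ} {g : MeroField} :
    τ g ∈ regularAt β ↔ g ∈ regularAt (β + 1) := by
  constructor
  · rintro ⟨p, q, hq, h⟩
    refine ⟨p.comp (Polynomial.X - 1), q.comp (Polynomial.X - 1), by simpa using hq, ?_⟩
    apply τ_injective
    rw [map_mul, τ_aeval, τ_aeval, comp_assoc, comp_assoc]
    simpa using h
  · rintro ⟨p, q, hq, h⟩
    refine ⟨p.comp (Polynomial.X + 1), q.comp (Polynomial.X + 1), by simpa using hq, ?_⟩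
    rw [← τ_aeval, ← τ_aeval, ← map_mul, h]

theorem finite_not_mem_regularAt {g : MeroField} (hg : g ∈ baseField) :
    {β | g ∉ regularAt β}.Finite := by
  obtain ⟨p, q, rfl⟩ := (IntermediateField.mem_adjoin_simple_iff periodicField g).1 hg
  -- For `q = 0` the quotient is zero by convention, hence regular everywhere.
  by_cases hq : q = 0
  · convert Set.finite_empty
    ext β
    simp [hq]
  · have h0 : aeval X q ≠ 0 := fun h => hq (aeval_X_eq_zero_iff.1 h)
    have hfin : {x | q.IsRoot x}.Finite := Polynomial.finite_setOfPred_isRoot hq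
    refine (hfin.preimage (f := algebraMap ℂ periodicField)
      (algebraMap ℂ periodicField).injective.injOn).subset fun β hβ => ?_
    by_contra h
    exact hβ ⟨p, q, h, div_mul_cancel₀ _ h0⟩

theorem aeval_X_sub_C (r : ℂ) :
    aeval X (Polynomial.X - C (algebraMap ℂ periodicField r)) = X - const r := by
  rw [map_sub, aeval_X, aeval_C]
  rfl

theorem X_sub_const_mem_regularAt (r β : ℂ) : X - const r ∈ regularAt β :=
  ⟨Polynomial.X - C (algebraMap ℂ periodicField r), 1, by simp, by
    rw [aeval_X_sub_C, map_one, mul_one]⟩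

theorem inv_X_sub_const_mem_regularAt {r β : ℂ} (h : β ≠ r) : (X - const r)⁻¹ ∈ regularAt β := by
  refine ⟨1, Polynomial.X - C (algebraMap ℂ periodicField r), ?_, ?_⟩
  · rw [eval_sub, eval_X, eval_C, sub_ne_zero]
    exact fun h' => h ((algebraMap ℂ periodicField).injective h')
  · rw [aeval_X_sub_C, map_one, inv_mul_cancel₀ (X_sub_const_ne_zero r)]

theorem inv_X_sub_const_not_mem_regularAt (r : ℂ) : (X - const r)⁻¹ ∉ regularAt r := by
  rintro ⟨p, q, hq, h⟩
  -- By transcendence of `x` the relation holds between polynomials, `q = p (x - r)`, so `q`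
  -- vanishes at `r`.
  have h1 : aeval X (q - p * (Polynomial.X - C (algebraMap ℂ periodicField r))) = 0 := by
    rw [map_sub, map_mul, aeval_X_sub_C, ← h]
    field_simp [X_sub_const_ne_zero r]
    ring
  rw [aeval_X_eq_zero_iff, sub_eq_zero] at h1
  apply hq
  rw [h1]
  simp

/-- A nonzero principal part is not regular. -/
theorem eq_zero_of_sum_mem_regularAt (r : ℂ) (d : ℕ → periodicField) (N : ℕ)
    (h : ∑ i ∈ Finset.range N, d i • ((X - const r)⁻¹) ^ (i + 1) ∈ regularAt r) :
    ∀ i < N, d i = 0 := by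
  induction N with
  | zero => intro i hi; omega
  | succ N ih =>
    have ht := X_sub_const_ne_zero r
    have htop : d N = 0 := by
      by_contra hd
      apply inv_X_sub_const_not_mem_regularAt r
      -- Multiplying by `(x - r)^N` makes every term regular except the top one, which becomes `d N
      -- / (x - r)`.
      have h1 := (regularAt r).mul_mem ((regularAt r).pow_mem (X_sub_const_mem_regularAt r r) N) h
      rw [Finset.sum_range_succ, mul_add, show ∀ (x : MeroField) (f : ℕ → MeroField),
        x * ∑ i ∈ Finset.range N, f i = ∑ i ∈ Finset.range N, x * f i from
        fun x f => Finset.mul_sum _ f x] at h1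
      have h2 : ∑ i ∈ Finset.range N, (X - const r) ^ N * d i • ((X - const r)⁻¹) ^ (i + 1) ∈
          regularAt r := by
        refine (regularAt r).sum_mem fun i hi => ?_
        have hi' : N = (N - (i + 1)) + (i + 1) := by have := Finset.mem_range.1 hi; omega
        rw [mul_smul_comm, hi', pow_add, mul_assoc, ← mul_pow, mul_inv_cancel₀ ht, one_pow, mul_one]
        exact (regularAt r).smul_mem ((regularAt r).pow_mem (X_sub_const_mem_regularAt r r) _) _
      have h3 := (add_mem_cancel_left h2).1 h1
      rw [mul_smul_comm, pow_succ, ← mul_assoc, ← mul_pow, mul_inv_cancel₀ ht, one_pow, one_mul]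
        at h3
      have h4 := (regularAt r).smul_mem h3 (d N)⁻¹
      rwa [inv_smul_smul₀ hd] at h4
    rw [Finset.sum_range_succ, htop, zero_smul, add_zero] at h
    intro i hi
    rcases Nat.lt_succ_iff_lt_or_eq.1 hi with hi | rfl
    · exact ih h i hi
    · exact htop

/-- Only finitely many points are poles. This supplies a regular point on either side of `r`, from
which `coboundary_mem_regularAt` starts. -/
theorem exists_nat_mem_regularAt {g : MeroField} (hg : g ∈ baseField) (r : ℂ) (s : ℤ)
    (hs : s ≠ 0) : ∃ N : ℕ, g ∈ regularAt (r + ((s * (N + 1) : ℤ) : ℂ)) := by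
  by_contra! h
  refine (Set.infinite_range_of_injective
    (f := fun N : ℕ => r + ((s * (N + 1) : ℤ) : ℂ)) fun m n hmn => ?_)
    ((finite_not_mem_regularAt hg).subset ?_)
  · have h1 : s * ((m : ℤ) + 1) = s * (n + 1) := by exact_mod_cast add_left_cancel hmn
    have := mul_left_cancel₀ hs h1
    omega
  · rintro _ ⟨N, rfl⟩
    exact h N

/-- A coboundary in `k(x)` cannot have exactly one pole in a `ℤ`-orbit. -/
theorem coboundary_mem_regularAt {g : MeroField} (hg : g ∈ baseField) (r : ℂ)
    (h : ∀ m : ℤ, m ≠ 0 → τ g - g ∈ regularAt (r + m)) : τ g - g ∈ regularAt r := by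
  -- Regularity of `g` travels along the orbit wherever `τ g - g` is regular: from the right down to
  -- `r + 1`, from the left up to `r`. Neither walk uses the hypothesis at `m = 0`, and the two end
  -- points make `τ g` and `g` regular at `r`.
  have hup : ∀ N : ℕ, g ∈ regularAt (r + ((1 * (N + 1) : ℤ) : ℂ)) → g ∈ regularAt (r + 1) := by
    intro N
    induction N with
    | zero => intro h; simpa using h
    | succ N ih =>
      intro hN
      apply ih
      have h1 : τ g ∈ regularAt (r + ((1 * (N + 1) : ℤ) : ℂ)) := by
        rw [τ_mem_regularAt_iff]
        convert hN using 1
        push_cast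
        ring_nf
      have h2 := sub_mem h1 (h (1 * (N + 1) : ℤ) (by omega))
      rwa [sub_sub_cancel] at h2
  have hdown : ∀ N : ℕ, g ∈ regularAt (r + ((-1 * (N + 1) : ℤ) : ℂ)) → g ∈ regularAt r := by
    intro N
    have step : ∀ N : ℕ, g ∈ regularAt (r + ((-1 * (N + 1) : ℤ) : ℂ)) →
        g ∈ regularAt (r + ((-1 * N : ℤ) : ℂ)) := by
      intro N hN
      have h2 := add_mem (h (-1 * (N + 1) : ℤ) (by omega)) hN
      rw [sub_add_cancel, τ_mem_regularAt_iff] at h2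
      convert h2 using 1
      push_cast
      ring_nf
    induction N with
    | zero => intro h; simpa using step 0 h
    | succ N ih => intro hN; exact ih (by simpa using step (N + 1) hN)
  obtain ⟨N, hN⟩ := exists_nat_mem_regularAt hg r 1 one_ne_zero
  obtain ⟨M, hM⟩ := exists_nat_mem_regularAt hg r (-1) (by norm_num)
  exact sub_mem (τ_mem_regularAt_iff.2 (hup N hN)) (hdown M hM)

end Regular

/-! ### Shift normal form of rational functions -/

section Factorization

/-- Products of powers of `x - r`. -/
noncomputable def linearProd (n : ℂ →₀ ℤ) : MeroField := n.prod fun r k => (X - const r) ^ k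

theorem linearProd_add (m n : ℂ →₀ ℤ) : linearProd (m + n) = linearProd m * linearProd n :=
  Finsupp.prod_add_index' (fun _ => zpow_zero _)
    fun r _ _ => zpow_add₀ (X_sub_const_ne_zero r) _ _

theorem linearProd_zero : linearProd 0 = 1 := Finsupp.prod_zero_index

theorem linearProd_neg (n : ℂ →₀ ℤ) : linearProd (-n) = (linearProd n)⁻¹ := by
  apply eq_inv_of_mul_eq_one_left
  rw [← linearProd_add, neg_add_cancel, linearProd_zero]

theorem linearProd_single (r : ℂ) : linearProd (Finsupp.single r 1) = X - const r := by
  simp [linearProd, Finsupp.prod_single_index]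

theorem linearProd_ne_zero (n : ℂ →₀ ℤ) : linearProd n ≠ 0 :=
  Finset.prod_ne_zero_iff.2 fun r _ => zpow_ne_zero _ (X_sub_const_ne_zero r)

/-- `a` is, up to a constant and a multiplicative coboundary, a product of powers of `x - r`
with `r` in the strip `0 ≤ re r < 1`. -/
def HasShiftNormalForm (a : MeroField) : Prop :=
  ∃ (n : ℂ →₀ ℤ) (c : ℂ) (h : MeroField), (∀ r ∈ n.support, ⌊r.re⌋ = 0) ∧ c ≠ 0 ∧
    h ∈ ratField ∧ h ≠ 0 ∧ a = const c * linearProd n * (τ h / h)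

theorem HasShiftNormalForm.mul {a b : MeroField} (ha : HasShiftNormalForm a)
    (hb : HasShiftNormalForm b) : HasShiftNormalForm (a * b) := by
  classical
  obtain ⟨n, c, h, hn, hc, hh, hh0, rfl⟩ := ha
  obtain ⟨n', c', h', hn', hc', hh', hh0', rfl⟩ := hb
  refine ⟨n + n', c * c', h * h', ?_, mul_ne_zero hc hc', mul_mem hh hh', mul_ne_zero hh0 hh0', ?_⟩
  · intro r hr
    rcases Finset.mem_union.1 (Finsupp.support_add hr) with h | h
    · exact hn r h
    · exact hn' r h
  · rw [linearProd_add, const_mul, map_mul]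
    field_simp

theorem HasShiftNormalForm.inv {a : MeroField} (ha : HasShiftNormalForm a) :
    HasShiftNormalForm a⁻¹ := by
  obtain ⟨n, c, h, hn, hc, hh, hh0, rfl⟩ := ha
  refine ⟨-n, c⁻¹, h⁻¹, ?_, inv_ne_zero hc, inv_mem hh, inv_ne_zero hh0, ?_⟩
  · intro r hr
    rw [Finsupp.support_neg] at hr
    exact hn r hr
  · rw [linearProd_neg, const_inv, map_inv₀, mul_inv, mul_inv, inv_div, inv_div_inv]

theorem hasShiftNormalForm_const {c : ℂ} (hc : c ≠ 0) : HasShiftNormalForm (const c) :=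
  ⟨0, c, 1, by simp, hc, one_mem _, one_ne_zero, by simp [linearProd_zero]⟩

theorem hasShiftNormalForm_coboundary {h : MeroField} (hh : h ∈ ratField) (h0 : h ≠ 0) :
    HasShiftNormalForm (τ h / h) :=
  ⟨0, 1, h, by simp, one_ne_zero, hh, h0, by simp [linearProd_zero]⟩

/-- `x - s` and `x - (s + 1)` differ by the multiplicative coboundary of `x - (s + 1)`, so `r` can
be moved into the strip by integer steps. -/
theorem hasShiftNormalForm_X_sub_const (r : ℂ) : HasShiftNormalForm (X - const r) := by
  have hstep : ∀ s : ℂ, HasShiftNormalForm (X - const s) ↔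
      HasShiftNormalForm (X - const (s + 1)) := by
    intro s
    have h0 := X_sub_const_ne_zero (s + 1)
    have h0' := X_sub_const_ne_zero s
    have hτ : τ (X - const (s + 1)) = X - const s := by
      rw [map_sub, τ_X, τ_const]
      simp only [const, map_add, map_one]
      ring
    have hcob := hasShiftNormalForm_coboundary (X_sub_const_mem_ratField (s + 1)) h0
    rw [hτ] at hcob
    constructor
    · intro h
      convert h.mul hcob.inv using 1
      field_simp
    · intro h
      convert h.mul hcob using 1
      field_simp
  have hbase : HasShiftNormalForm (X - const (r - ⌊r.re⌋)) := by
    refine ⟨Finsupp.single (r - ⌊r.re⌋) 1, 1, 1, ?_, one_ne_zero, one_mem _, one_ne_zero, ?_⟩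
    · intro s hs
      have : s = r - ⌊r.re⌋ := by simpa using Finsupp.support_single_subset hs
      rw [this]
      simp
    · rw [linearProd_single]
      simp
  have hall : ∀ m : ℤ, HasShiftNormalForm (X - const (r - ⌊r.re⌋ + m)) := by
    intro m
    induction m using Int.induction_on with
    | zero => simpa using hbase
    | succ i ih =>
      rw [hstep] at ih
      convert ih using 3
      push_cast
      ring
    | pred i ih =>
      rw [hstep]
      convert ih using 3
      push_cast
      ring
  simpa using hall ⌊r.re⌋

theorem hasShiftNormalForm_aeval {p : ℂ[X]} (hp : p ≠ 0) : HasShiftNormalForm (aeval X p) := by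
  rw [(IsAlgClosed.splits p).eq_prod_roots, map_mul, aeval_C]
  refine (hasShiftNormalForm_const (leadingCoeff_ne_zero.2 hp)).mul ?_
  induction p.roots using Multiset.induction_on with
  | empty =>
    simpa using hasShiftNormalForm_const one_ne_zero
  | cons r s ih =>
    rw [Multiset.map_cons, Multiset.prod_cons, map_mul, map_sub, aeval_X, aeval_C]
    exact (hasShiftNormalForm_X_sub_const r).mul ih

theorem hasShiftNormalForm_of_mem_ratField {a : MeroField} (ha : a ∈ ratField) (h0 : a ≠ 0) :
    HasShiftNormalForm a := by
  obtain ⟨p, q, rfl⟩ := (IntermediateField.mem_adjoin_simple_iff ℂ a).1 ha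
  have hp : p ≠ 0 := by rintro rfl; simp at h0
  have hq : q ≠ 0 := by rintro rfl; simp at h0
  rw [div_eq_mul_inv]
  exact (hasShiftNormalForm_aeval hp).mul (hasShiftNormalForm_aeval hq).inv

end Factorization

end MeroDiff

/-! ### The two implications -/

namespace MeroDiff

theorem τ_iterate_D (i : ℕ) (f : MeroField) : τ (D^[i] f) = D^[i] (τ f) := by
  induction i with
  | zero => rfl
  | succ i ih => rw [Function.iterate_succ_apply', Function.iterate_succ_apply', ← D_τ, ih]

theorem τ_logDeriv (f : MeroField) : τ (D f / f) = D (τ f) / τ f := by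
  rw [map_div₀, D_τ]

theorem logDeriv_const (c : ℂ) : D (const c) / const c = 0 := by
  rw [D_const, zero_div]

theorem logDeriv_linearProd (n : ℂ →₀ ℤ) :
    D (linearProd n) / linearProd n = ∑ r ∈ n.support, (n r : MeroField) * (X - const r)⁻¹ := by
  rw [linearProd, Finsupp.prod,
    D.logDeriv_prod _ _ fun r _ => zpow_ne_zero _ (X_sub_const_ne_zero r)]
  refine Finset.sum_congr rfl fun r _ => ?_
  rw [D.logDeriv_zpow (X_sub_const_ne_zero r), map_sub, D_X, D_const, sub_zero, one_div]

theorem iterate_D_inv_X_sub_const (r : ℂ) (i : ℕ) :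
    D^[i] (X - const r)⁻¹ =
      (((-1) ^ i * i.factorial : ℤ) : MeroField) * ((X - const r)⁻¹) ^ (i + 1) :=
  D.iterate_inv (by rw [map_sub, D_X, D_const, sub_zero]) i

/-- A nontrivial combination over `k` of derivatives of a logarithmic derivative whose poles lie
in the strip `0 ≤ re r < 1` is not a coboundary, unless there are no poles. -/
theorem eq_zero_of_sum_iterate_D_eq_coboundary {n : ℂ →₀ ℤ} (hn : ∀ r ∈ n.support, ⌊r.re⌋ = 0)
    {N : ℕ} {c : Fin N → MeroField} (hc : ∀ i, c i ∈ periodicField) (hc0 : c ≠ 0)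
    {g : MeroField} (hg : g ∈ baseField)
    (h : ∑ i, c i * D^[i] (D (linearProd n) / linearProd n) = τ g - g) : n = 0 := by
  classical
  by_contra hn0
  obtain ⟨r₀, hr₀⟩ := Finsupp.support_nonempty_iff.2 hn0
  -- `d i` absorbs the nonzero factor `(-1)^i i!` from the `i`-th derivative of a simple pole; `w r`
  -- is then the principal part at `r`, up to the weight `n r`.
  let d : ℕ → periodicField := fun i =>
    if hi : i < N then ((-1) ^ i * i.factorial : ℤ) • (⟨c ⟨i, hi⟩, hc _⟩ : periodicField) else 0
  let w : ℂ → MeroField := fun r => ∑ i ∈ Finset.range N, d i • ((X - const r)⁻¹) ^ (i + 1)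
  have hw : ∑ r ∈ n.support, n r • w r = τ g - g := by
    rw [← h]
    have h1 : ∀ i : Fin N, c i * D^[i] (D (linearProd n) / linearProd n) =
        ∑ r ∈ n.support, n r • (d i • ((X - const r)⁻¹) ^ ((i : ℕ) + 1)) := by
      intro i
      rw [logDeriv_linearProd, D.iterate_sum_intCast_mul,
        show ∀ (x : MeroField) (s : Finset ℂ) (f : ℂ → MeroField),
          x * ∑ i ∈ s, f i = ∑ i ∈ s, x * f i from fun x s f => Finset.mul_sum s f x]
      refine Finset.sum_congr rfl fun r _ => ?_
      have hd : (d i : MeroField) = (((-1) ^ (i : ℕ) * (i : ℕ).factorial : ℤ) : MeroField) * c i := by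
        simp only [d, i.2, dif_pos]
        rw [← zsmul_eq_mul]
        rfl
      rw [iterate_D_inv_X_sub_const, zsmul_eq_mul, IntermediateField.smul_def, smul_eq_mul, hd]
      ring
    rw [Finset.sum_congr rfl fun i _ => h1 i, Finset.sum_comm]
    refine Finset.sum_congr rfl fun r _ => ?_
    rw [← Finset.smul_sum, Fin.sum_univ_eq_sum_range
      (fun i => d i • ((X - const r)⁻¹) ^ (i + 1)) N]
  have hreg : ∀ r β : ℂ, β ≠ r → w r ∈ regularAt β := fun r β hβ =>
    (regularAt β).sum_mem fun i _ => (regularAt β).smul_mem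
      ((regularAt β).pow_mem (inv_X_sub_const_mem_regularAt hβ) _) _
  have h1 : τ g - g ∈ regularAt r₀ := by
    -- Two points of the strip cannot differ by a nonzero integer, so no `r` in the support equals
    -- `r₀ + m`.
    refine coboundary_mem_regularAt hg r₀ fun m hm => ?_
    rw [← hw]
    refine (regularAt _).sum_mem fun r hr => (regularAt _).zsmul_mem (hreg r _ ?_) _
    rintro rfl
    have h2 := hn _ hr
    rw [Complex.add_re, Complex.intCast_re, Int.floor_add_intCast, hn r₀ hr₀, zero_add] at h2
    exact hm h2
  rw [← hw, ← Finset.add_sum_erase _ _ hr₀] at h1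
  have h2 : n r₀ • w r₀ ∈ regularAt r₀ := by
    refine (add_mem_cancel_right ?_).1 h1
    exact (regularAt _).sum_mem fun r hr => (regularAt _).zsmul_mem
      (hreg r _ (Finset.ne_of_mem_erase hr).symm) _
  have hnr : (n r₀ : MeroField) ≠ 0 := Int.cast_ne_zero.2 (Finsupp.mem_support_iff.1 hr₀)
  have h3 : w r₀ ∈ regularAt r₀ := by
    have h4 := (regularAt r₀).smul_mem h2 (n r₀ : periodicField)⁻¹
    rw [zsmul_eq_mul, IntermediateField.smul_def, smul_eq_mul] at h4
    exact inv_mul_cancel_left₀ hnr (w r₀) ▸ h4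
  have h4 := eq_zero_of_sum_mem_regularAt r₀ d N h3
  apply hc0
  ext i
  have h5 := h4 i i.2
  simp only [d, i.2, dif_pos, zsmul_eq_mul] at h5
  refine congrArg (algebraMap periodicField MeroField) ((mul_eq_zero.1 h5).resolve_left ?_)
  exact Int.cast_ne_zero.2 (mul_ne_zero (pow_ne_zero _ (by norm_num))
    (by exact_mod_cast i.1.factorial_ne_zero))

theorem exists_coboundary_of_differentiallyAlgebraic {a z : MeroField} (ha : a ∈ ratField)
    (ha0 : a ≠ 0) (hz0 : z ≠ 0) (hz : τ z = a * z)
    (hda : DifferentiallyAlgebraic baseField D z) :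
    ∃ g ∈ ratField, g ≠ 0 ∧ ∃ c : ℂ, a = const c * (τ g / g) := by
  have haK : a ∈ baseField := ratField_subset_baseField ha
  have hbK : D a / a ∈ baseField := div_mem (D_mem_baseField haK) haK
  obtain ⟨n, c, h, hn, hc, hh, hh0, hnf⟩ := hasShiftNormalForm_of_mem_ratField ha ha0
  obtain ⟨N, hdep⟩ := hda.logDeriv D fun f => ⟨⟨_, D_mem_baseField f.2⟩, rfl⟩
  have hy : τ (D z / z) = D z / z + D a / a := by
    rw [τ_logDeriv, hz, D.logDeriv_mul ha0 hz0, add_comm]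
  obtain ⟨k, e, hk0, hk, hsum⟩ := exists_coboundary_of_not_algebraicIndependent τBase
    (τ : MeroField →+* MeroField) algebraMap_τBase
    (fun i : Fin (N + 1) => (⟨D^[i] (D a / a), iterate_D_mem_baseField hbK i⟩ : baseField))
    (fun i : Fin (N + 1) => D^[i] (D z / z))
    (fun i => by
      change τ (D^[i] (D z / z)) = D^[i] (D z / z) + D^[i] (D a / a)
      rw [τ_iterate_D, hy, D.iterate_add]) hdep
  rw [finsum_eq_sum_of_fintype] at hsum
  have hsum' := congrArg (algebraMap baseField MeroField) hsum
  rw [map_sum, map_sub, ← algebraMap_τBase] at hsum'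
  have hkp : ∀ i, (k i : MeroField) ∈ periodicField := fun i =>
    congrArg (algebraMap baseField MeroField) (hk i)
  have hldh : D h / h ∈ baseField := div_mem (D_mem_baseField (ratField_subset_baseField hh))
    (ratField_subset_baseField hh)
  have hlda : D a / a = D (linearProd n) / linearProd n + (τ (D h / h) - D h / h) := by
    have hτh : τ h ≠ 0 := fun h' => hh0 (τ_injective (by rw [h', map_zero]))
    have hc' : const c ≠ 0 := (map_ne_zero (algebraMap ℂ MeroField)).2 hc
    rw [hnf, D.logDeriv_mul (mul_ne_zero hc' (linearProd_ne_zero n)) (div_ne_zero hτh hh0),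
      D.logDeriv_mul hc' (linearProd_ne_zero n), logDeriv_const, zero_add,
      D.logDeriv_div hτh hh0, τ_logDeriv]
  -- As the `k i` are periodic, the contribution of `h` is the coboundary of `∑ k i ∂ⁱ(∂h/h)`; it is
  -- moved to the right-hand side.
  have hg : (e : MeroField) - ∑ i, (k i : MeroField) * D^[i] (D h / h) ∈ baseField :=
    sub_mem e.2 (sum_mem fun i _ => mul_mem (k i).2 (iterate_D_mem_baseField hldh i))
  have hn0 : n = 0 := by
    refine eq_zero_of_sum_iterate_D_eq_coboundary hn hkp ?_ hg ?_
    · intro h0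
      exact hk0 (funext fun i => Subtype.ext (congrFun h0 i))
    · have h1 : ∀ i : Fin (N + 1), algebraMap baseField MeroField
          (k i * ⟨D^[i] (D a / a), iterate_D_mem_baseField hbK i⟩) =
          (k i : MeroField) * D^[i] (D (linearProd n) / linearProd n) +
          (τ ((k i : MeroField) * D^[i] (D h / h)) - (k i : MeroField) * D^[i] (D h / h)) := by
        intro i
        change (k i : MeroField) * D^[i] (D a / a) = _
        rw [hlda, sub_eq_add_neg, D.iterate_add, D.iterate_add, map_mul,
          mem_periodicField.1 (hkp i), τ_iterate_D, iterate_map_neg]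
        ring
      rw [Finset.sum_congr rfl fun i _ => h1 i, Finset.sum_add_distrib,
        show ∀ f g : Fin (N + 1) → MeroField, ∑ i, (f i - g i) = ∑ i, f i - ∑ i, g i from
          Finset.sum_sub_distrib, ← map_sum] at hsum'
      change _ = τ (e : MeroField) - e at hsum'
      rw [map_sub]
      linear_combination hsum'
  refine ⟨h, hh, hh0, c, ?_⟩
  rw [hnf, hn0, linearProd_zero, mul_one]

theorem differentiallyAlgebraic_of_D_eq_mul {u z : MeroField} (hu : u ∈ baseField)
    (h : D z = u * z) : DifferentiallyAlgebraic baseField D z := by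
  refine ⟨1, fun hind => ?_⟩
  have h1 : MvPolynomial.aeval (fun i : Fin 2 => D^[i] z)
      (MvPolynomial.X 1 - MvPolynomial.C (⟨u, hu⟩ : baseField) * MvPolynomial.X 0) = 0 := by
    rw [map_sub, map_mul, MvPolynomial.aeval_X, MvPolynomial.aeval_X, MvPolynomial.aeval_C]
    exact sub_eq_zero.2 h
  have h2 := (algebraicIndependent_iff.1 hind) _ h1
  -- The relation is a nonzero polynomial: its value at `(0, 1)` is `1`.
  have h3 := congrArg (MvPolynomial.eval (fun i : Fin 2 => if i = 1 then (1 : baseField) else 0)) h2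
  simp at h3

theorem differentiallyAlgebraic_of_coboundary {a z g : MeroField} {c : ℂ} (hg : g ∈ ratField)
    (hg0 : g ≠ 0) (ha0 : a ≠ 0) (hz0 : z ≠ 0) (hz : τ z = a * z) (ha : a = const c * (τ g / g)) :
    DifferentiallyAlgebraic baseField D z := by
  have hτg : τ g ≠ 0 := fun h => hg0 (τ_injective (by rw [h, map_zero]))
  have hgK := ratField_subset_baseField hg
  have hc : const c ≠ 0 := by
    intro h
    rw [h, zero_mul] at ha
    exact ha0 ha
  -- Dividing by `g` removes the coboundary, and the remaining constant factor has zero logarithmic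
  -- derivative.
  have hw : τ (z / g) = const c * (z / g) := by
    rw [map_div₀, hz, ha]
    field_simp
  have hp : D (z / g) / (z / g) ∈ periodicField := by
    rw [mem_periodicField, τ_logDeriv, hw, D.logDeriv_mul hc (div_ne_zero hz0 hg0), logDeriv_const,
      zero_add]
  rw [D.logDeriv_div hz0 hg0] at hp
  have hu : D z / z ∈ baseField := by
    have := add_mem (periodic_mem_baseField hp) (div_mem (D_mem_baseField hgK) hgK)
    rwa [sub_add_cancel] at this
  exact differentiallyAlgebraic_of_D_eq_mul hu (div_mul_cancel₀ _ hz0).symm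

end MeroDiff

theorem corollary6p4 (a z : MeroDiff.MeroField)
    (ha : a ∈ MeroDiff.ratField) (ha0 : a ≠ 0) (hz0 : z ≠ 0) (hz : MeroDiff.τ z = a * z) :
    MeroDiff.DifferentiallyAlgebraic MeroDiff.baseField MeroDiff.D z ↔
      ∃ g ∈ MeroDiff.ratField, g ≠ 0 ∧
        ∃ c : ℂ, a = algebraMap ℂ MeroDiff.MeroField c * (MeroDiff.τ g / g) := by
  constructor
  · exact MeroDiff.exists_coboundary_of_differentiallyAlgebraic ha ha0 hz0 hz
  · rintro ⟨g, hg, hg0, c, h⟩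
    exact MeroDiff.differentiallyAlgebraic_of_coboundary hg hg0 ha0 hz0 hz h
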